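/- Let $L\in\mathbb N$, let $H_0,\dots,H_{L-1}$ be (possibly unbounded) self-adjoint operators on a complex Hilbert space $\mathcal H$ with domains $\operatorname{Dom}H_j$, and for $t\in\mathbb R$ let $e^{-itH_j}$ denote the strongly continuous unitary group generated by $H_j$. For operators $A,B$ the product $AB$ has domain $\{x\in\operatorname{Dom}B: Bx\in\operatorname{Dom}A\}$, and a sum of operators has the intersection of the domains as its domain. Suppose that the sum $\sum_{j=0}^{L-1}H_j$, with domain $\bigcap_j\operatorname{Dom}H_j$, has an eigenvalue $h$ with eigenvector $\varphi\neq0$, and that $\varphi\in\bigcap_j\operatorname{Dom}H_j^2$. Let $g_0,\dots,g_{L-1}\in\mathbb R$ with $\sum_k g_k=1$, and put $H_k(g_k)=H_k-hg_k$. Assume also that $\sum_{i<k}H_i\varphi\in\operatorname{Dom}H_k$ for $0<k<L-1$ (a condition that is empty when $L\le2$). Then $\varphi$ lies in the domains of $H_k(g_k)^2$ and of $H_k(g_k)\sum_{i<k}H_i(g_i)$ for every $k$, and for all $t\in\mathbb R$ and all integers $N\ge1$ $$\Bigl\|\bigl(e^{-i\frac tN H_{L-1}}\cdots e^{-i\frac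 tN H_1}e^{-i\frac tN H_0}\bigr)^N\varphi-e^{-ith}\varphi\Bigr\|\le\frac{t^2}{N}\sum_{k=0}^{L-1}\Bigl(\tfrac12\bigl\|H_k(g_k)^2\varphi\bigr\|+\Bigl\|H_k(g_k)\sum_{i=0}^{k-1}H_i(g_i)\varphi\Bigr\|\Bigr).$$ The same bound holds with the factors in the opposite order, i.e. for $\bigl(e^{-i\frac tN H_0}e^{-i\frac tN H_1}\cdots e^{-i\frac tN H_{L-1}}\bigr)^N$. -/

import Mathlib

namespace StateTrotter

variable {E : Type*} [NormedAddCommGroup E] [InnerProductSpace ℂ E]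

/-- `U` is the strongly continuous one-parameter unitary group `t ↦ e^{-itH}` generated by the
(possibly unbounded) operator `H`: `x` belongs to the domain of `H` and `H x = y` exactly when
`t ↦ U t x` is differentiable at `0` with derivative `-i y`. -/
structure IsUnitaryGroupOf [CompleteSpace E] (H : E →ₗ.[ℂ] E) (U : ℝ → E →L[ℂ] E) : Prop where
  mem_unitary : ∀ t, U t ∈ unitary (E →L[ℂ] E)
  map_zero : U 0 = 1
  map_add : ∀ s t, U (s + t) = U s * U t
  continuous_apply : ∀ x, Continuous fun t => U t x
  mem_graph_iff : ∀ x y, (x, y) ∈ H.graph ↔ HasDerivAt (fun t => U t x) (-(Complex.I • y)) 0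

/-- The evolution of a vector in the domain stays in the domain and solves the Schrödinger
equation. -/
theorem IsUnitaryGroupOf.hasDerivAt [CompleteSpace E] {H : E →ₗ.[ℂ] E} {U : ℝ → E →L[ℂ] E}
    (hU : IsUnitaryGroupOf H U) {x y : E} (hxy : (x, y) ∈ H.graph) (t : ℝ) :
    (U t x, U t y) ∈ H.graph ∧
      HasDerivAt (fun s => U s x) (-(Complex.I • U t y)) t := by
  have h0 := (hU.mem_graph_iff x y).1 hxy
  have h1 : HasDerivAt (fun s => U t (U s x)) (U t (-(Complex.I • y))) 0 :=
    ((U t).restrictScalars ℝ).hasFDerivAt.comp_hasDerivAt (0 : ℝ) h0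
  rw [_root_.map_neg, map_smul] at h1
  constructor
  · rw [hU.mem_graph_iff]
    refine h1.congr_of_eventuallyEq (Filter.Eventually.of_forall fun s => ?_)
    have : U s * U t = U t * U s := by rw [← hU.map_add, ← hU.map_add, add_comm]
    exact congrArg (fun T : E →L[ℂ] E => T x) this
  · have h2 : HasDerivAt (fun s => U t (U s x)) (-(Complex.I • U t y)) (t - t) := by
      rwa [sub_self]
    have h3 := h2.comp_sub_const t t
    refine h3.congr_of_eventuallyEq (Filter.Eventually.of_forall fun s => ?_)
    have : U s = U t * U (s - t) := by rw [← hU.map_add, add_sub_cancel]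
    exact congrArg (fun T : E →L[ℂ] E => T x) this

/-- A self-adjoint operator generates at most one unitary group. -/
theorem IsUnitaryGroupOf.unique [CompleteSpace E] {H : E →ₗ.[ℂ] E} (hH : IsSelfAdjoint H)
    {U V : ℝ → E →L[ℂ] E} (hU : IsUnitaryGroupOf H U) (hV : IsUnitaryGroupOf H V) : U = V := by
  funext t
  have hsymm : ∀ {x y : E}, (x, y) ∈ H.graph → inner ℂ x y = inner ℂ y x := by
    intro x y hxy
    have hF := LinearPMap.adjoint_isFormalAdjoint hH.dense_domain
    rw [LinearPMap.isSelfAdjoint_def.1 hH] at hF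
    obtain ⟨a, h1, h2⟩ := (LinearPMap.mem_graph_iff H).1 hxy
    have := hF a a
    rw [h1, h2] at this
    exact this.symm
  have key : Set.EqOn (U t) (V t) (H.domain : Set E) := by
    intro x hx
    have hxy : (x, H ⟨x, hx⟩) ∈ H.graph := LinearPMap.mem_graph H ⟨x, hx⟩
    set y := H ⟨x, hx⟩
    have hd : ∀ s, HasDerivAt (fun s => inner ℂ (U s x - V s x) (U s x - V s x)) 0 s := by
      intro s
      obtain ⟨hu, hu'⟩ := hU.hasDerivAt hxy s
      obtain ⟨hv, hv'⟩ := hV.hasDerivAt hxy s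
      have hw : inner ℂ (U s x - V s x) (U s y - V s y) =
          inner ℂ (U s y - V s y) (U s x - V s x) := hsymm (H.graph.sub_mem hu hv)
      have hw' := hu'.sub hv'
      have hc : -(Complex.I • U s y) - -(Complex.I • V s y) =
          -(Complex.I • (U s y - V s y)) := by rw [smul_sub]; abel
      rw [hc] at hw'
      have := hw'.inner ℂ hw'
      refine this.congr_deriv ?_
      simp only [Pi.sub_apply, inner_neg_left, inner_neg_right, inner_smul_left, inner_smul_right,
        Complex.conj_I, hw]
      ring
    have hconst := is_const_of_deriv_eq_zero (fun s => (hd s).differentiableAt)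
      (fun s => (hd s).deriv) t 0
    simp only [hU.map_zero, hV.map_zero, sub_self, inner_zero_left] at hconst
    exact sub_eq_zero.1 (inner_self_eq_zero.1 hconst)
  exact DFunLike.coe_injective
    (Continuous.ext_on hH.dense_domain (U t).continuous (V t).continuous key)

open Classical in
/-- The operator `e^{-itH}`: the value at `t` of the unitary group generated by `H`, which exists
and is unique when `H` is self-adjoint (the value is the identity if `H` generates no unitary
group). -/
noncomputable def expNegI [CompleteSpace E] (H : E →ₗ.[ℂ] E) (t : ℝ) : E →L[ℂ] E :=
  if h : ∃ U : ℝ → E →L[ℂ] E, IsUnitaryGroupOf H U then h.choose t else 1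

/-- The operator `H - c`, with the same domain as `H`. -/
def shift (H : E →ₗ.[ℂ] E) (c : ℂ) : E →ₗ.[ℂ] E where
  domain := H.domain
  toFun := H.toFun - c • H.domain.subtype

/-- The product `A B` of two unbounded operators on its natural domain
`{x ∈ Dom B | B x ∈ Dom A}`. -/
noncomputable def mulOp (A B : E →ₗ.[ℂ] E) : E →ₗ.[ℂ] E :=
  A.comp (B.domRestrict ((A.domain.comap B.toFun).map B.domain.subtype)) (by
    rintro ⟨x, ⟨z, hz, rfl⟩, hx⟩
    exact hz)

theorem mem_domain_mulOp (A B : E →ₗ.[ℂ] E) (x : E) :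
    x ∈ (mulOp A B).domain ↔ ∃ hx : x ∈ B.domain, B ⟨x, hx⟩ ∈ A.domain := by
  constructor
  · rintro ⟨⟨z, hz, rfl⟩, hx⟩
    exact ⟨hx, hz⟩
  · rintro ⟨hx, hx'⟩
    exact ⟨⟨⟨x, hx⟩, hx', rfl⟩, hx⟩

theorem mulOp_apply (A B : E →ₗ.[ℂ] E) {x : E} (hx : x ∈ B.domain)
    (hx' : B ⟨x, hx⟩ ∈ A.domain) :
    mulOp A B ⟨x, (mem_domain_mulOp A B x).2 ⟨hx, hx'⟩⟩ = A ⟨B ⟨x, hx⟩, hx'⟩ := rfl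

/-- One Trotter step `e^{-isH_{L-1}} ⋯ e^{-isH_1} e^{-isH_0}` (the factor with index `0` acts
first). -/
noncomputable def trotterStep [CompleteSpace E] {L : ℕ} (H : Fin L → E →ₗ.[ℂ] E) (s : ℝ) :
    E →L[ℂ] E :=
  (List.ofFn fun j => expNegI (H j) s).reverse.prod

/-- One Trotter step in the opposite order, `e^{-isH_0} e^{-isH_1} ⋯ e^{-isH_{L-1}}`. -/
noncomputable def trotterStepRev [CompleteSpace E] {L : ℕ} (H : Fin L → E →ₗ.[ℂ] E) (s : ℝ) :
    E →L[ℂ] E :=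
  (List.ofFn fun j => expNegI (H j) s).prod

end StateTrotter

namespace StateTrotter

/-! ### Resolvents and bounded approximants of a self-adjoint operator. -/

section SelfAdjoint

variable {E : Type*} [NormedAddCommGroup E] [InnerProductSpace ℂ E] [CompleteSpace E]
  {H : E →ₗ.[ℂ] E}

/-! Replacing `H k` by `H k - h * g k` multiplies each factor by a phase and, since the `g k` sum to
one, the whole step by `e^{ish}`. So it suffices to bound how far the product of the isometries `W k
= e^{-is(H k - h g k)}` moves `φ`, where the vectors `y k = (H k - h g k) φ` now sum to zero.

Each new factor `W k` carries the earlier remainder isometrically and adds two errors: its own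
Taylor remainder at `φ`, which is at most half of `s²` times the norm of `(H k - h g k)² φ`, and
`|s|` times the displacement of `∑_{i<k} y i`, which is at most `s²` times the mixed term
(`norm_prod_reverse_apply_sub_le`). The total linear term vanishes. By isometry, `N` steps cost at
most `N` times one step, and `s = t/N` yields `t²/N` (`norm_pow_apply_sub_exp_smul_le`). The
opposite order is the inverse of the original product at time `-s`, and inverting an isometry
preserves the displacement of a vector (`norm_shifted_trotterStepRev_sub_eq`).

Because `expNegI` has a default value, all this requires Stone's theorem
(`exists_isUnitaryGroupOf`). The group is obtained as the strong limit of `e^{-itB}` for commuting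
bounded approximants `B` of `H` built from resolvents. -/

theorem mem_graph_iff_forall_inner (hH : IsSelfAdjoint H) {x y : E} :
    (x, y) ∈ H.graph ↔ ∀ a b, (a, b) ∈ H.graph → inner ℂ b x = inner ℂ a y := by
  have hG := LinearPMap.adjoint_graph_eq_graph_adjoint hH.dense_domain
  rw [LinearPMap.isSelfAdjoint_def.1 hH] at hG
  conv_lhs => rw [hG, Submodule.mem_adjoint_iff]
  simp only [sub_eq_zero]

theorem inner_graph_comm (hH : IsSelfAdjoint H) {x y a b : E} (hxy : (x, y) ∈ H.graph)
    (hab : (a, b) ∈ H.graph) : inner ℂ b x = inner ℂ a y :=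
  (mem_graph_iff_forall_inner hH).1 hxy a b hab

/-- The cross term vanishes because the quadratic form of a symmetric operator is real. -/
theorem norm_sq_add_smul_of_mem_graph (hH : IsSelfAdjoint H) {x y : E} (hxy : (x, y) ∈ H.graph)
    (c : ℝ) : ‖y + (c * Complex.I) • x‖ ^ 2 = ‖y‖ ^ 2 + c ^ 2 * ‖x‖ ^ 2 := by
  have h1 := inner_graph_comm hH hxy hxy
  have h2 : (inner ℂ y x : ℂ).im = 0 := by
    rw [← Complex.conj_eq_iff_im, inner_conj_symm, h1]
  rw [@norm_add_sq ℂ, inner_smul_right, norm_smul]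
  simp [h2, mul_pow]

theorem abs_mul_norm_le_of_mem_graph (hH : IsSelfAdjoint H) {x y : E} (hxy : (x, y) ∈ H.graph)
    (c : ℝ) : |c| * ‖x‖ ≤ ‖y + (c * Complex.I) • x‖ := by
  refine le_of_sq_le_sq ?_ (norm_nonneg _)
  rw [norm_sq_add_smul_of_mem_graph hH hxy, mul_pow, sq_abs]
  nlinarith [sq_nonneg ‖y‖]

theorem norm_le_of_mem_graph (hH : IsSelfAdjoint H) {x y : E} (hxy : (x, y) ∈ H.graph)
    (c : ℝ) : ‖y‖ ≤ ‖y + (c * Complex.I) • x‖ := by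
  refine le_of_sq_le_sq ?_ (norm_nonneg _)
  rw [norm_sq_add_smul_of_mem_graph hH hxy]
  nlinarith [sq_nonneg (c * ‖x‖)]

/-- `R` is the resolvent `(H + ic)⁻¹`. -/
def IsResolvent (H : E →ₗ.[ℂ] E) (c : ℝ) (R : E →L[ℂ] E) : Prop :=
  ∀ v, (R v, v - (c * Complex.I) • R v) ∈ H.graph

/-- The resolvent `(H + ic)⁻¹` of a self-adjoint operator at a nonzero imaginary point. -/
theorem exists_resolvent (hH : IsSelfAdjoint H) {c : ℝ} (hc : c ≠ 0) :
    ∃ R : E →L[ℂ] E, IsResolvent H c R := by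
  have hclosed : IsClosed (H.graph : Set (E × E)) := hH.isClosed
  have : CompleteSpace H.graph := hclosed.completeSpace_coe
  let f : H.graph →L[ℂ] E :=
    (ContinuousLinearMap.snd ℂ E E + (c * Complex.I) • ContinuousLinearMap.fst ℂ E E).comp
      H.graph.subtypeL
  have hf : ∀ p : H.graph, f p = p.1.2 + (c * Complex.I) • p.1.1 := fun p => rfl
  have hc' : 0 < |c| := abs_pos.2 hc
  -- The graph carries the max norm, so the sum of the bounds for the two components serves. Being
  -- bounded below on a complete space, `f` has closed range.
  have hanti : AntilipschitzWith (1 + ⟨|c|⁻¹, by positivity⟩) f := by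
    refine ContinuousLinearMap.antilipschitz_of_bound f fun p => ?_
    have h1 := abs_mul_norm_le_of_mem_graph hH p.2 c
    have h2 := norm_le_of_mem_graph hH p.2 c
    rw [← hf] at h1 h2
    have h3 : ‖p.1.1‖ ≤ |c|⁻¹ * ‖f p‖ := by
      rw [inv_mul_eq_div, le_div_iff₀ hc']; linarith
    have h4 : (0 : ℝ) ≤ |c|⁻¹ * ‖f p‖ := by positivity
    have h5 : ‖p‖ = max ‖p.1.1‖ ‖p.1.2‖ := rfl
    have h6 : (((1 + ⟨|c|⁻¹, by positivity⟩ : NNReal)) : ℝ) = 1 + |c|⁻¹ := rfl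
    rw [h5, h6, add_mul, one_mul]
    exact max_le (by linarith [norm_nonneg (f p)]) (by linarith)
  have hrc : IsClosed (f.range : Set E) := by
    rw [LinearMap.coe_range]
    exact hanti.isClosed_range f.uniformContinuous
  have : CompleteSpace f.range := hrc.completeSpace_coe
  -- By self-adjointness, a vector `v` orthogonal to the range satisfies `H v = ic v`; the lower
  -- bound at `-c` then forces `v = 0`.
  have hrange : f.range = ⊤ := by
    rw [← Submodule.orthogonal_eq_bot_iff, Submodule.eq_bot_iff]
    intro v hv
    rw [Submodule.mem_orthogonal] at hv
    have hmem : (v, (c * Complex.I) • v) ∈ H.graph := by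
      rw [mem_graph_iff_forall_inner hH]
      intro a b hab
      have := hv (f ⟨(a, b), hab⟩) ⟨⟨(a, b), hab⟩, rfl⟩
      rw [hf, inner_add_left, inner_smul_left] at this
      rw [inner_smul_right]
      simp only [map_mul, Complex.conj_I, Complex.conj_ofReal] at this
      linear_combination this
    have h1 := abs_mul_norm_le_of_mem_graph hH hmem (-c)
    rw [← add_smul] at h1
    simp only [Complex.ofReal_neg, neg_mul, add_neg_cancel, zero_smul, norm_zero, abs_neg] at h1
    have : ‖v‖ ≤ 0 := by
      by_contra hcon
      have := mul_pos hc' (not_le.1 hcon)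
      linarith
    exact norm_le_zero_iff.1 this
  have hker : f.ker = ⊥ := LinearMap.ker_eq_bot.2 hanti.injective
  let e := ContinuousLinearEquiv.ofBijective f hker hrange
  refine ⟨(ContinuousLinearMap.fst ℂ E E).comp (H.graph.subtypeL.comp (e.symm : E →L[ℂ] H.graph)),
    fun v => ?_⟩
  have h1 : f (e.symm v) = v := ContinuousLinearEquiv.ofBijective_apply_symm_apply f hker hrange v
  rw [hf] at h1
  have h2 : v - (c * Complex.I) • (e.symm v).1.1 = (e.symm v).1.2 := by
    rw [eq_comm, eq_sub_iff_add_eq, h1]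
  change ((e.symm v).1.1, v - (c * Complex.I) • (e.symm v).1.1) ∈ H.graph
  rw [h2]
  exact (e.symm v).2

namespace IsResolvent

variable {c d : ℝ} {R S : E →L[ℂ] E}

theorem abs_mul_norm_le (hH : IsSelfAdjoint H) (hR : IsResolvent H c R) (v : E) :
    |c| * ‖R v‖ ≤ ‖v‖ := by
  simpa using abs_mul_norm_le_of_mem_graph hH (hR v) c

/-- By definition `R` is only a right inverse of `H + ic`; the lower bound makes `H + ic` injective,
so `R` is a left inverse too. -/
theorem apply_of_mem_graph (hH : IsSelfAdjoint H) (hR : IsResolvent H c R) (hc : c ≠ 0) {x y : E}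
    (hxy : (x, y) ∈ H.graph) : R y + (c * Complex.I) • R x = x := by
  rw [← map_smul, ← map_add]
  set v := y + (c * Complex.I) • x with hv
  have h1 := abs_mul_norm_le_of_mem_graph hH (H.graph.sub_mem (hR v) hxy) c
  have h2 : v - (c * Complex.I) • R v - y + (c * Complex.I) • (R v - x) = 0 := by
    rw [hv, smul_sub]; abel
  simp only [h2, norm_zero] at h1
  have : ‖R v - x‖ ≤ 0 := by
    by_contra hcon
    have := mul_pos (abs_pos.2 hc) (not_le.1 hcon)
    linarith
  exact sub_eq_zero.1 (norm_le_zero_iff.1 this)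

/-- Comparing both products through `S R S v` avoids dividing by `c - d`, so the case `c = d` is
included. -/
theorem commute (hH : IsSelfAdjoint H) (hR : IsResolvent H c R) (hS : IsResolvent H d S)
    (hc : c ≠ 0) (hd : d ≠ 0) : Commute R S := by
  ext v
  change R (S v) = S (R v)
  have h1 := hR.apply_of_mem_graph hH hc (hS v)
  rw [map_sub, map_smul] at h1
  have h2 := hS.apply_of_mem_graph hH hd (hR (S v))
  rw [map_sub, map_smul] at h2
  have h3 := congrArg S h1
  rw [map_add, map_sub, map_smul, map_smul] at h3
  rw [← h2, ← h3]
  abel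

theorem inner_apply (hH : IsSelfAdjoint H) (hR : IsResolvent H c R) (hS : IsResolvent H (-c) S)
    (v w : E) : inner ℂ (R v) w = inner ℂ v (S w) := by
  have h := inner_graph_comm hH (hS w) (hR v)
  simp only [inner_sub_left, inner_sub_right, inner_smul_left, inner_smul_right, map_mul,
    Complex.conj_I, Complex.conj_ofReal, Complex.ofReal_neg] at h
  linear_combination -h

end IsResolvent

/-- A self-adjoint operator is the strong limit, on its domain, of commuting bounded self-adjoint
operators. -/
theorem exists_bounded_approximation (hH : IsSelfAdjoint H) :
    ∃ B : ℕ → E →L[ℂ] E, (∀ n, IsSelfAdjoint (B n)) ∧ (∀ m n, Commute (B m) (B n)) ∧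
      ∀ x y, (x, y) ∈ H.graph → Filter.Tendsto (fun n => B n x) Filter.atTop (nhds y) := by
  have hpos : ∀ n : ℕ, (n : ℝ) + 1 ≠ 0 := fun n => by positivity
  choose R hR using fun n : ℕ => exists_resolvent hH (hpos n)
  choose S hS using fun n : ℕ => exists_resolvent hH (neg_ne_zero.2 (hpos n))
  let a : ℕ → ℝ := fun n => n + 1
  have hbR : ∀ n v, a n * ‖R n v‖ ≤ ‖v‖ := fun n v => by
    have := (hR n).abs_mul_norm_le hH v
    rwa [abs_of_nonneg (by positivity)] at this
  have hbS : ∀ n v, a n * ‖S n v‖ ≤ ‖v‖ := fun n v => by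
    have := (hS n).abs_mul_norm_le hH v
    rwa [abs_neg, abs_of_nonneg (by positivity)] at this
  have heR : ∀ n {x y}, (x, y) ∈ H.graph → R n y + (a n * Complex.I) • R n x = x :=
    fun n _ _ hxy => (hR n).apply_of_mem_graph hH (hpos n) hxy
  have heS : ∀ n {x y}, (x, y) ∈ H.graph → S n y - (a n * Complex.I) • S n x = x :=
    fun n _ _ hxy => by
      have := (hS n).apply_of_mem_graph hH (neg_ne_zero.2 (hpos n)) hxy
      rwa [Complex.ofReal_neg, neg_mul, neg_smul, ← sub_eq_add_neg] at this
  have hlim : Filter.Tendsto (fun n => (a n)⁻¹) Filter.atTop (nhds 0) := by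
    simpa [a] using tendsto_one_div_add_atTop_nhds_zero_nat (𝕜 := ℝ)
  -- Formally `B = a²H/(H² + a²)` and `J = a²/(H² + a²)`, so that `B = J H` on the domain of `H`.
  let B : ℕ → E →L[ℂ] E := fun n => ((a n : ℂ) ^ 2 / 2) • (R n + S n)
  let J : ℕ → E →L[ℂ] E := fun n => ((a n : ℂ) * Complex.I / 2) • (R n - S n)
  have hBJ : ∀ n x y, (x, y) ∈ H.graph → B n x = J n y := by
    intro n x y hxy
    have h1 : R n y = x - (a n * Complex.I) • R n x := eq_sub_of_add_eq (heR n hxy)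
    have h2 : S n y = x + (a n * Complex.I) • S n x := eq_add_of_sub_eq (heS n hxy)
    have h3 : (a n : ℂ) * Complex.I / 2 * (a n * Complex.I) = -(a n ^ 2 / 2) := by
      linear_combination (a n : ℂ) ^ 2 / 2 * Complex.I_mul_I
    simp only [B, J, smul_apply, add_apply,
      sub_apply, h1, h2]
    have h4 : x - (a n * Complex.I) • R n x - (x + (a n * Complex.I) • S n x) =
      -((a n * Complex.I) • (R n x + S n x)) := by module
    rw [h4, smul_neg, smul_smul, h3, neg_smul, neg_neg]
  have hJb : ∀ n v, ‖J n v‖ ≤ ‖v‖ := by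
    intro n v
    have h1 : ‖(a n : ℂ) * Complex.I / 2‖ = a n / 2 := by
      rw [norm_div, norm_mul, Complex.norm_I, Complex.norm_real, mul_one, Real.norm_of_nonneg
        (by positivity)]
      norm_num
    have h2 : J n v = ((a n : ℂ) * Complex.I / 2) • (R n v - S n v) := rfl
    rw [h2, norm_smul, h1]
    have h3 := norm_sub_le (R n v) (S n v)
    have h4 : 0 < a n := by positivity
    nlinarith [hbR n v, hbS n v]
  -- `J n` tends strongly to the identity: at rate `1 / a n` on the dense domain, hence everywhere,
  -- since `J n` is a contraction.
  have hJ : ∀ y, Filter.Tendsto (fun n => J n y) Filter.atTop (nhds y) := by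
    have hdense : ∀ z w, (z, w) ∈ H.graph → ∀ n, ‖J n z - z‖ ≤ (a n)⁻¹ * ‖w‖ := by
      intro z w hzw n
      have h4 : 0 < a n := by positivity
      have h5 : J n z - z = -((1 / 2 : ℂ) • (R n w + S n w)) := by
        have h1 : R n w = z - (a n * Complex.I) • R n z := eq_sub_of_add_eq (heR n hzw)
        have h2 : S n w = z + (a n * Complex.I) • S n z := eq_add_of_sub_eq (heS n hzw)
        rw [h1, h2]
        simp only [J, smul_apply, sub_apply]
        module
      rw [h5, norm_neg, norm_smul, inv_mul_eq_div, le_div_iff₀ h4]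
      have h3 := norm_add_le (R n w) (S n w)
      norm_num
      nlinarith [hbR n w, hbS n w]
    intro y
    rw [Metric.tendsto_atTop]
    intro ε hε
    obtain ⟨z, hz, hyz⟩ := Metric.mem_closure_iff.1 (hH.dense_domain y) (ε / 3) (by positivity)
    obtain ⟨w, hzw⟩ : ∃ w, (z, w) ∈ H.graph := ⟨_, LinearPMap.mem_graph H ⟨z, hz⟩⟩
    have hl : Filter.Tendsto (fun n => (a n)⁻¹ * ‖w‖) Filter.atTop (nhds 0) := by
      simpa using hlim.mul_const ‖w‖
    obtain ⟨n0, hn0⟩ := Filter.eventually_atTop.1 (hl.eventually_lt_const (by positivity : 0 < ε / 3))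
    refine ⟨n0, fun n hn => ?_⟩
    have h1 := hdense z w hzw n
    have h2 := hn0 n hn
    have h3 := hJb n (y - z)
    rw [dist_eq_norm] at hyz ⊢
    have h4 : J n y - y = J n (y - z) + (J n z - z) - (y - z) := by
      rw [map_sub]; abel
    rw [h4]
    have h5 := norm_sub_le (J n (y - z) + (J n z - z)) (y - z)
    have h6 := norm_add_le (J n (y - z)) (J n z - z)
    linarith
  refine ⟨B, fun n => ?_, fun m n => ?_, fun x y hxy => ?_⟩
  · rw [ContinuousLinearMap.isSelfAdjoint_iff_isSymmetric]
    intro v w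
    have h1 := (hR n).inner_apply hH (hS n) v w
    have h2 := (hR n).inner_apply hH (hS n) w v
    have h3 : inner ℂ (S n v) w = inner ℂ v (R n w) := by
      rw [← inner_conj_symm, ← h2, inner_conj_symm]
    have h4 : (starRingEnd ℂ) ((a n : ℂ) ^ 2 / 2) = (a n : ℂ) ^ 2 / 2 := by
      rw [show (a n : ℂ) ^ 2 / 2 = ((a n ^ 2 / 2 : ℝ) : ℂ) by push_cast; rfl, Complex.conj_ofReal]
    change inner ℂ (((a n : ℂ) ^ 2 / 2) • (R n v + S n v)) w =
      inner ℂ v (((a n : ℂ) ^ 2 / 2) • (R n w + S n w))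
    rw [inner_smul_left, inner_smul_right, h4, inner_add_left, inner_add_right, h1, h3, add_comm]
  · have h1 : Commute (R m + S m) (R n + S n) := by
      have hm := hpos m
      have hn := hpos n
      exact (((hR m).commute hH (hR n) hm hn).add_right
        ((hR m).commute hH (hS n) hm (neg_ne_zero.2 hn))).add_left
        (((hS m).commute hH (hR n) (neg_ne_zero.2 hm) hn).add_right
        ((hS m).commute hH (hS n) (neg_ne_zero.2 hm) (neg_ne_zero.2 hn)))
    exact (h1.smul_left _).smul_right _
  · simp only [hBJ _ x y hxy]
    exact hJ y

end SelfAdjoint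

/-! ### A mean value inequality with affine derivative bound. -/

section Bounds

variable {F : Type*} [NormedAddCommGroup F] [NormedSpace ℝ F]

theorem norm_le_of_hasDerivAt_bound {f f' : ℝ → F} {b c : ℝ} (h0 : f 0 = 0)
    (hf : ∀ t, HasDerivAt f (f' t) t) (hb : ∀ t, ‖f' t‖ ≤ b + c * |t|) (t : ℝ) :
    ‖f t‖ ≤ b * |t| + c / 2 * t ^ 2 := by
  have key : ∀ (f f' : ℝ → F), f 0 = 0 → (∀ t, HasDerivAt f (f' t) t) →
      (∀ t, ‖f' t‖ ≤ b + c * |t|) → ∀ t, 0 ≤ t → ‖f t‖ ≤ b * t + c / 2 * t ^ 2 := by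
    intro f f' h0 hf hb t ht
    refine image_norm_le_of_norm_deriv_right_le_deriv_boundary' (a := 0) (b := t)
      (f' := f') (B := fun t => b * t + c / 2 * t ^ 2) (B' := fun t => b + c * t)
      (fun x _ => (hf x).continuousAt.continuousWithinAt)
      (fun x _ => (hf x).hasDerivWithinAt) (by simp [h0]) (by fun_prop)
      (fun x _ => ?_) (fun x hx => ?_) ⟨ht, le_rfl⟩
    · have h := ((hasDerivAt_id x).const_mul b).add
        (((hasDerivAt_id x).pow 2).const_mul (c / 2))
      refine HasDerivAt.hasDerivWithinAt (h.congr_deriv ?_)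
      simp
      ring
    · simpa [abs_of_nonneg hx.1] using hb x
  rcases le_total 0 t with ht | ht
  · rw [abs_of_nonneg ht]
    exact key f f' h0 hf hb t ht
  · have := key (fun s => f (-s)) (fun s => -f' (-s)) (by simpa using h0)
      (fun s => by simpa [Function.comp_def] using (hf (-s)).scomp s (hasDerivAt_neg s))
      (fun s => by simpa using hb (-s)) (-t) (by linarith)
    simpa [abs_of_nonpos ht] using this

end Bounds

/-! ### Unitary groups of bounded self-adjoint operators. -/

section BoundedEvolution

variable {E : Type*} [NormedAddCommGroup E] [InnerProductSpace ℂ E] [CompleteSpace E]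

/-- The unitary group `e^{-itB}` of a bounded operator. -/
noncomputable def boundedEvolution (B : E →L[ℂ] E) (t : ℝ) : E →L[ℂ] E :=
  NormedSpace.exp (t • (-(Complex.I • B)))

variable {B C : E →L[ℂ] E}

theorem boundedEvolution_zero : boundedEvolution B 0 = 1 := by
  simp [boundedEvolution]

theorem boundedEvolution_add (s t : ℝ) :
    boundedEvolution B (s + t) = boundedEvolution B s * boundedEvolution B t := by
  let _ : NormedAlgebra ℚ (E →L[ℂ] E) := NormedAlgebra.restrictScalars ℚ ℂ _
  rw [boundedEvolution, add_smul]
  exact NormedSpace.exp_add_of_commute (((Commute.refl _).smul_left s).smul_right t)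

theorem boundedEvolution_add_of_commute (h : Commute B C) (t : ℝ) :
    boundedEvolution (B + C) t = boundedEvolution B t * boundedEvolution C t := by
  let _ : NormedAlgebra ℚ (E →L[ℂ] E) := NormedAlgebra.restrictScalars ℚ ℂ _
  rw [boundedEvolution, smul_add, neg_add, smul_add]
  exact NormedSpace.exp_add_of_commute
    ((((h.smul_left _).smul_right _).neg_left.neg_right.smul_left t).smul_right t)

theorem boundedEvolution_mem_unitary (hB : IsSelfAdjoint B) (t : ℝ) :
    boundedEvolution B t ∈ unitary (E →L[ℂ] E) := by
  let _ : NormedAlgebra ℚ (E →L[ℂ] E) := NormedAlgebra.restrictScalars ℚ ℂ _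
  refine NormedSpace.exp_mem_unitary_of_mem_skewAdjoint ?_
  rw [skewAdjoint.mem_iff]
  simp [star_smul, hB.star_eq]

theorem norm_apply_of_mem_unitary {U : E →L[ℂ] E} (hU : U ∈ unitary (E →L[ℂ] E)) (x : E) :
    ‖U x‖ = ‖x‖ :=
  ContinuousLinearMap.norm_map_of_mem_unitary hU x

theorem hasDerivAt_boundedEvolution (x : E) (t : ℝ) :
    HasDerivAt (fun s => boundedEvolution B s x) (-(Complex.I • boundedEvolution B t (B x))) t := by
  have h := hasDerivAt_exp_smul_const (𝕂 := ℝ) (-(Complex.I • B)) t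
  have h' := (((ContinuousLinearMap.apply ℂ E x).restrictScalars ℝ).hasFDerivAt).comp_hasDerivAt t h
  refine h'.congr_deriv ?_
  simp [boundedEvolution]

theorem norm_boundedEvolution_sub_le (hB : IsSelfAdjoint B) (x : E) (t : ℝ) :
    ‖boundedEvolution B t x - x‖ ≤ ‖B x‖ * |t| := by
  have := norm_le_of_hasDerivAt_bound (f := fun s => boundedEvolution B s x - x) (b := ‖B x‖)
    (c := 0) (by simp [boundedEvolution_zero])
    (fun s => (hasDerivAt_boundedEvolution x s).sub_const x)
    (fun s => by
      simp [norm_smul, norm_apply_of_mem_unitary (boundedEvolution_mem_unitary hB s)]) t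
  simpa using this

/-- Commutation factors out `e^{-itC}`, leaving the displacement of `x` under `e^{-it(B - C)}`. -/
theorem norm_boundedEvolution_sub_boundedEvolution_le (hB : IsSelfAdjoint B)
    (hC : IsSelfAdjoint C) (h : Commute B C) (x : E) (t : ℝ) :
    ‖boundedEvolution B t x - boundedEvolution C t x‖ ≤ ‖B x - C x‖ * |t| := by
  have h1 : Commute C (B - C) := h.symm.sub_right (Commute.refl C)
  have h2 := boundedEvolution_add_of_commute h1 t
  rw [add_sub_cancel] at h2
  have h3 : boundedEvolution B t x - boundedEvolution C t x =
      boundedEvolution C t (boundedEvolution (B - C) t x - x) := by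
    rw [h2, map_sub]; rfl
  rw [h3, norm_apply_of_mem_unitary (boundedEvolution_mem_unitary hC t)]
  exact norm_boundedEvolution_sub_le (hB.sub hC) x t

/-- First-order expansion of `e^{-itB} x` whose remainder involves an auxiliary vector `z` close
to `B x` in place of `B (B x)`. -/
theorem norm_boundedEvolution_sub_add_le (hB : IsSelfAdjoint B) (x z : E) (t : ℝ) :
    ‖boundedEvolution B t x - x + t • Complex.I • B x‖ ≤
      2 * ‖B x - z‖ * |t| + ‖B z‖ / 2 * t ^ 2 := by
  have hd : ∀ s, HasDerivAt (fun s : ℝ => boundedEvolution B s x - x + s • Complex.I • B x)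
      (-(Complex.I • (boundedEvolution B s (B x) - B x))) s := by
    intro s
    have h := ((hasDerivAt_boundedEvolution (B := B) x s).sub_const x).add
      ((hasDerivAt_id s).smul_const (Complex.I • B x))
    refine h.congr_deriv ?_
    rw [one_smul, smul_sub]; abel
  refine norm_le_of_hasDerivAt_bound (by simp [boundedEvolution_zero]) hd (fun s => ?_) t
  rw [norm_neg, norm_smul, Complex.norm_I, one_mul]
  -- The part `B x - z` is moved by at most twice its norm and `z` by at most `‖B z‖ * |s|`. No
  -- control of `B (B x)` is needed, which matters when `B x` approximates a vector outside the
  -- domain of `H`.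
  have h1 : boundedEvolution B s (B x) - B x = boundedEvolution B s (B x - z) - (B x - z) +
      (boundedEvolution B s z - z) := by rw [map_sub]; abel
  have h2 := norm_boundedEvolution_sub_le hB z s
  have h3 := norm_apply_of_mem_unitary (boundedEvolution_mem_unitary hB s) (B x - z)
  rw [h1]
  have h4 := norm_add_le (boundedEvolution B s (B x - z) - (B x - z)) (boundedEvolution B s z - z)
  have h5 := norm_sub_le (boundedEvolution B s (B x - z)) (B x - z)
  linarith

end BoundedEvolution

/-! ### Stone's theorem. -/

section Stone

variable {E : Type*} [NormedAddCommGroup E] [InnerProductSpace ℂ E] [CompleteSpace E]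
  {H : E →ₗ.[ℂ] E}

open Filter Topology

theorem exists_mem_graph_dist_lt (hH : IsSelfAdjoint H) (x : E) {ε : ℝ} (hε : 0 < ε) :
    ∃ z w, (z, w) ∈ H.graph ∧ ‖x - z‖ < ε := by
  obtain ⟨z, hz, hxz⟩ := Metric.mem_closure_iff.1 (hH.dense_domain x) ε hε
  exact ⟨z, _, LinearPMap.mem_graph H ⟨z, hz⟩, by rwa [← dist_eq_norm]⟩

/-- The commuting estimate gives the Cauchy property on the domain; density and isometry extend it
to every vector. -/
theorem exists_tendsto_boundedEvolution (hH : IsSelfAdjoint H) {B : ℕ → E →L[ℂ] E}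
    (hB : ∀ n, IsSelfAdjoint (B n)) (hcomm : ∀ m n, Commute (B m) (B n))
    (hlim : ∀ x y, (x, y) ∈ H.graph → Tendsto (fun n => B n x) atTop (𝓝 y)) (t : ℝ) (x : E) :
    ∃ y, Tendsto (fun n => boundedEvolution (B n) t x) atTop (𝓝 y) := by
  refine cauchySeq_tendsto_of_complete (Metric.cauchySeq_iff.2 fun ε hε => ?_)
  obtain ⟨z, w, hzw, hxz⟩ := exists_mem_graph_dist_lt hH x (by positivity : 0 < ε / 3)
  obtain ⟨n0, hn0⟩ := Metric.cauchySeq_iff.1 (hlim z w hzw).cauchySeq (ε / (3 * (|t| + 1)))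
    (by positivity)
  refine ⟨n0, fun m hm n hn => ?_⟩
  have h1 := norm_boundedEvolution_sub_boundedEvolution_le (hB m) (hB n) (hcomm m n) z t
  have h2 := hn0 m hm n hn
  rw [dist_eq_norm, lt_div_iff₀ (by positivity)] at h2
  have h3 := norm_apply_of_mem_unitary (boundedEvolution_mem_unitary (hB m) t) (x - z)
  have h4 := norm_apply_of_mem_unitary (boundedEvolution_mem_unitary (hB n) t) (x - z)
  have h5 : boundedEvolution (B m) t x - boundedEvolution (B n) t x =
      boundedEvolution (B m) t (x - z) + (boundedEvolution (B m) t z -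
        boundedEvolution (B n) t z) - boundedEvolution (B n) t (x - z) := by
    simp only [map_sub]; abel
  rw [dist_eq_norm, h5]
  have h6 := norm_sub_le (boundedEvolution (B m) t (x - z) + (boundedEvolution (B m) t z -
        boundedEvolution (B n) t z)) (boundedEvolution (B n) t (x - z))
  have h7 := norm_add_le (boundedEvolution (B m) t (x - z)) (boundedEvolution (B m) t z -
        boundedEvolution (B n) t z)
  nlinarith [norm_nonneg (B m z - B n z)]

theorem mem_unitary_of_norm_map {U V : E →L[ℂ] E} (hU : ∀ x, ‖U x‖ = ‖x‖) (hUV : U * V = 1) :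
    U ∈ unitary (E →L[ℂ] E) := by
  have h1 : star U * U = 1 := (ContinuousLinearMap.norm_map_iff_adjoint_comp_self U).1 hU
  have h2 : star U = V := by
    rw [← mul_one (star U), ← hUV, ← mul_assoc, h1, one_mul]
  exact ⟨h1, h2 ▸ hUV⟩

/-- **Stone's theorem**: a self-adjoint operator generates a strongly continuous unitary group. -/
theorem exists_isUnitaryGroupOf (hH : IsSelfAdjoint H) :
    ∃ U : ℝ → E →L[ℂ] E, IsUnitaryGroupOf H U := by
  obtain ⟨B, hB, hcomm, hlim⟩ := exists_bounded_approximation hH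
  choose u hu using exists_tendsto_boundedEvolution hH hB hcomm hlim
  let U : ℝ → E →L[ℂ] E := fun t => continuousLinearMapOfTendsto
    (fun n => boundedEvolution (B n) t) (tendsto_pi_nhds.2 (hu t))
  have hU : ∀ t x, Tendsto (fun n => boundedEvolution (B n) t x) atTop (𝓝 (U t x)) := hu
  have hnorm : ∀ t x, ‖U t x‖ = ‖x‖ := fun t x =>
    tendsto_nhds_unique (hU t x).norm (by
      simp only [norm_apply_of_mem_unitary (boundedEvolution_mem_unitary (hB _) t)]
      exact tendsto_const_nhds)
  have hzero : U 0 = 1 := by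
    ext x
    refine tendsto_nhds_unique (hU 0 x) ?_
    simp only [boundedEvolution_zero]
    exact tendsto_const_nhds
  have hadd : ∀ s t, U (s + t) = U s * U t := by
    intro s t
    ext x
    refine tendsto_nhds_unique (hU (s + t) x) ?_
    -- Both factors vary with `n`; isometry of the outer one absorbs the error of the inner one.
    have h1 : Tendsto (fun n => boundedEvolution (B n) s (boundedEvolution (B n) t x - U t x))
        atTop (𝓝 0) := by
      rw [tendsto_zero_iff_norm_tendsto_zero]
      simp only [norm_apply_of_mem_unitary (boundedEvolution_mem_unitary (hB _) s)]
      exact tendsto_iff_norm_sub_tendsto_zero.1 (hU t x)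
    have h2 := h1.add (hU s (U t x))
    rw [zero_add] at h2
    refine h2.congr fun n => ?_
    rw [map_sub, sub_add_cancel, boundedEvolution_add]
    rfl
  have hunit : ∀ t, U t ∈ unitary (E →L[ℂ] E) := fun t =>
    mem_unitary_of_norm_map (hnorm t) (V := U (-t)) (by rw [← hadd, add_neg_cancel, hzero])
  have hlip : ∀ x y, (x, y) ∈ H.graph → ∀ t, ‖U t x - x‖ ≤ ‖y‖ * |t| := fun x y hxy t =>
    le_of_tendsto_of_tendsto' ((hU t x).sub_const x).norm ((hlim x y hxy).norm.mul_const |t|)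
      fun n => norm_boundedEvolution_sub_le (hB n) x t
  have hexp : ∀ x y z w, (x, y) ∈ H.graph → (z, w) ∈ H.graph → ∀ t,
      ‖U t x - x + t • Complex.I • y‖ ≤ 2 * ‖y - z‖ * |t| + ‖w‖ / 2 * t ^ 2 := by
    intro x y z w hxy hzw t
    refine le_of_tendsto_of_tendsto'
      (((hU t x).sub_const x).add (((hlim x y hxy).const_smul Complex.I).const_smul t)).norm
      (((((hlim x y hxy).sub_const z).norm.const_mul 2).mul_const |t|).add
        (((hlim z w hzw).norm.div_const 2).mul_const (t ^ 2)))
      fun n => norm_boundedEvolution_sub_add_le (hB n) x z t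
  have hderiv : ∀ x y, (x, y) ∈ H.graph → HasDerivAt (fun t => U t x) (-(Complex.I • y)) 0 := by
    intro x y hxy
    rw [hasDerivAt_iff_isLittleO, Asymptotics.isLittleO_iff]
    intro c hc
    -- Since `y` need not lie in the domain, a nearby `z` replaces it. The linear and the quadratic
    -- term of `hexp` each receive `c / 2`.
    obtain ⟨z, w, hzw, hyz⟩ := exists_mem_graph_dist_lt hH y (by positivity : 0 < c / 4)
    filter_upwards [Metric.ball_mem_nhds (0 : ℝ) (by positivity : 0 < c / (‖w‖ + 1))] with t ht
    rw [mem_ball_zero_iff, Real.norm_eq_abs, lt_div_iff₀ (by positivity)] at ht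
    have h1 := hexp x y z w hxy hzw t
    rw [hzero, sub_zero, smul_neg, sub_neg_eq_add, Real.norm_eq_abs]
    refine h1.trans ?_
    rw [← sq_abs t]
    have h2 : 2 * ‖y - z‖ + ‖w‖ / 2 * |t| ≤ c := by nlinarith [abs_nonneg t]
    nlinarith [abs_nonneg t]
  refine ⟨U, hunit, hzero, hadd, fun x => ?_, fun x y => ⟨fun hxy => ?_, fun hd => ?_⟩⟩
  · rw [Metric.continuous_iff]
    intro s ε hε
    obtain ⟨z, w, hzw, hxz⟩ := exists_mem_graph_dist_lt hH x (by positivity : 0 < ε / 3)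
    refine ⟨ε / (3 * (‖w‖ + 1)), by positivity, fun t ht => ?_⟩
    rw [Real.dist_eq, lt_div_iff₀ (by positivity)] at ht
    have h1 : U t x - U s x = U s (U (t - s) (x - z) + (U (t - s) z - z) - (x - z)) := by
      have h2 : U t x = U s (U (t - s) x) := by
        rw [← add_sub_cancel s t, hadd, add_sub_cancel]; rfl
      rw [h2, ← map_sub, map_sub (U (t - s))]
      congr 1
      abel
    rw [dist_eq_norm, h1, hnorm]
    have h3 := norm_sub_le (U (t - s) (x - z) + (U (t - s) z - z)) (x - z)
    have h4 := norm_add_le (U (t - s) (x - z)) (U (t - s) z - z)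
    rw [hnorm] at h4
    have h5 := hlip z w hzw (t - s)
    nlinarith [abs_nonneg (t - s)]
  · exact hderiv x y hxy
  -- Differentiating the constant inner product of `U t a` and `U t x` at `0` puts `(x, y)` in the
  -- graph of the adjoint, which is that of `H`.
  · rw [mem_graph_iff_forall_inner hH]
    intro a b hab
    have h1 := (hderiv a b hab).inner ℂ hd
    have h2 : (fun t => inner ℂ (U t a) (U t x)) = fun _ => inner ℂ a x := by
      funext t
      exact ContinuousLinearMap.inner_map_map_of_mem_unitary (hunit t) a x
    rw [h2] at h1
    have h3 := h1.unique (hasDerivAt_const 0 _)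
    simp only [hzero, one_apply_eq_self, inner_neg_left, inner_neg_right,
      inner_smul_left, inner_smul_right, Complex.conj_I] at h3
    have h4 : Complex.I * (inner ℂ b x - inner ℂ a y) = 0 := by linear_combination h3
    exact sub_eq_zero.1 ((mul_eq_zero.1 h4).resolve_left Complex.I_ne_zero)

/-- The operators `e^{-itH}` form the unitary group generated by `H`. -/
theorem isUnitaryGroupOf_expNegI (hH : IsSelfAdjoint H) : IsUnitaryGroupOf H (expNegI H) := by
  have h := exists_isUnitaryGroupOf hH
  have : expNegI H = h.choose := by
    funext t
    rw [expNegI, dif_pos h]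
  rw [this]
  exact h.choose_spec

end Stone

/-! ### Graphs of shifts, products and sums of unbounded operators. -/

section Graph

variable {E : Type*} [NormedAddCommGroup E] [InnerProductSpace ℂ E]

theorem mem_graph_shift {H : E →ₗ.[ℂ] E} {c : ℂ} {x y : E} :
    (x, y) ∈ (shift H c).graph ↔ (x, y + c • x) ∈ H.graph := by
  simp only [LinearPMap.mem_graph_iff]
  constructor
  · rintro ⟨a, rfl, ha⟩
    refine ⟨a, rfl, ?_⟩
    rw [← ha]
    exact (sub_add_cancel (H a) (c • (a : E))).symm
  · rintro ⟨a, rfl, ha⟩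
    refine ⟨a, rfl, ?_⟩
    exact sub_eq_of_eq_add ha

theorem mem_graph_mulOp {A B : E →ₗ.[ℂ] E} {x y z : E} (hxy : (x, y) ∈ B.graph)
    (hyz : (y, z) ∈ A.graph) : (x, z) ∈ (mulOp A B).graph := by
  obtain ⟨⟨x, hx⟩, rfl, rfl⟩ := (LinearPMap.mem_graph_iff _).1 hxy
  obtain ⟨⟨y, hy⟩, hyx, rfl⟩ := (LinearPMap.mem_graph_iff _).1 hyz
  obtain rfl : y = B ⟨x, hx⟩ := hyx
  exact (LinearPMap.mem_graph_iff _).2 ⟨_, rfl, mulOp_apply A B hx hy⟩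

theorem mem_domain_of_mem_domain_mulOp {A B : E →ₗ.[ℂ] E} {x y : E}
    (hx : x ∈ (mulOp A B).domain) (hxy : (x, y) ∈ B.graph) : y ∈ A.domain := by
  obtain ⟨hx, hx'⟩ := (mem_domain_mulOp A B x).1 hx
  obtain rfl := LinearPMap.mem_graph_snd_inj B hxy (LinearPMap.mem_graph B ⟨x, hx⟩) rfl
  exact hx'

theorem eq_of_mem_graph {A : E →ₗ.[ℂ] E} {x y : E} (hx : x ∈ A.domain) (hxy : (x, y) ∈ A.graph) :
    A ⟨x, hx⟩ = y :=
  LinearPMap.mem_graph_snd_inj A (LinearPMap.mem_graph A ⟨x, hx⟩) hxy rfl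

theorem mem_domain_of_mem_domain_sum {ι : Type*} {s : Finset ι} {A : ι → E →ₗ.[ℂ] E} {x : E}
    (hx : x ∈ (∑ i ∈ s, A i).domain) : ∀ i ∈ s, x ∈ (A i).domain := by
  classical
  induction s using Finset.induction_on with
  | empty => simp
  | insert i s his ih =>
    rw [Finset.sum_insert his] at hx
    have h := Submodule.mem_inf.1 hx
    simpa using ⟨h.1, ih h.2⟩

theorem mem_graph_sum {ι : Type*} {s : Finset ι} {A : ι → E →ₗ.[ℂ] E} {x : E} {y : ι → E}
    (h : ∀ i ∈ s, (x, y i) ∈ (A i).graph) : (x, ∑ i ∈ s, y i) ∈ (∑ i ∈ s, A i).graph := by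
  classical
  induction s using Finset.induction_on with
  | empty => exact (LinearPMap.mem_graph_iff _).2 ⟨⟨x, Submodule.mem_top⟩, rfl, rfl⟩
  | insert i s his ih =>
    rw [Finset.sum_insert his, Finset.sum_insert his]
    have hi := h i (Finset.mem_insert_self i s)
    have hs := ih fun j hj => h j (Finset.mem_insert_of_mem hj)
    have hxi := LinearPMap.mem_domain_of_mem_graph hi
    have hxs := LinearPMap.mem_domain_of_mem_graph hs
    exact (LinearPMap.mem_graph_iff _).2 ⟨⟨x, hxi, hxs⟩, rfl,
      congrArg₂ (· + ·) (eq_of_mem_graph hxi hi) (eq_of_mem_graph hxs hs)⟩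

end Graph

/-! ### Taylor estimates for the shifted groups. -/

section ShiftedEvolution

variable {E : Type*} [NormedAddCommGroup E] [InnerProductSpace ℂ E] [CompleteSpace E]

/-- The operator `e^{-it(H - c)}`, as a multiple of `e^{-itH}`. -/
noncomputable def shiftedEvolution (H : E →ₗ.[ℂ] E) (c t : ℝ) : E →L[ℂ] E :=
  Complex.exp (Complex.I * c * t) • expNegI H t

variable {H : E →ₗ.[ℂ] E} {c : ℝ}

theorem norm_exp_I_mul_mul (c t : ℝ) : ‖Complex.exp (Complex.I * c * t)‖ = 1 := by
  rw [Complex.norm_exp]; simp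

theorem norm_shiftedEvolution_apply (hH : IsSelfAdjoint H) (t : ℝ) (x : E) :
    ‖shiftedEvolution H c t x‖ = ‖x‖ := by
  rw [shiftedEvolution, smul_apply, norm_smul, norm_exp_I_mul_mul, one_mul,
    norm_apply_of_mem_unitary ((isUnitaryGroupOf_expNegI hH).mem_unitary t)]

theorem shiftedEvolution_zero (hH : IsSelfAdjoint H) : shiftedEvolution H c 0 = 1 := by
  simp [shiftedEvolution, (isUnitaryGroupOf_expNegI hH).map_zero]

theorem shiftedEvolution_mul_neg (hH : IsSelfAdjoint H) (t : ℝ) :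
    shiftedEvolution H c t * shiftedEvolution H c (-t) = 1 := by
  rw [shiftedEvolution, shiftedEvolution, smul_mul_smul_comm, ← Complex.exp_add,
    ← (isUnitaryGroupOf_expNegI hH).map_add]
  simp [(isUnitaryGroupOf_expNegI hH).map_zero]

theorem hasDerivAt_shiftedEvolution (hH : IsSelfAdjoint H) {x y : E}
    (hxy : (x, y) ∈ (shift H c).graph) (t : ℝ) :
    HasDerivAt (fun s => shiftedEvolution H c s x) (-(Complex.I • shiftedEvolution H c t y)) t := by
  have h1 := ((isUnitaryGroupOf_expNegI hH).hasDerivAt (mem_graph_shift.1 hxy) t).2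
  have h2 : HasDerivAt (fun s : ℝ => Complex.exp (Complex.I * c * s))
      (Complex.exp (Complex.I * c * t) * (Complex.I * c)) t := by
    have := ((Complex.ofRealCLM.hasDerivAt (x := t)).const_mul (Complex.I * c)).cexp
    simpa using this
  refine (h2.smul h1).congr_deriv ?_
  simp only [shiftedEvolution, smul_apply, map_add, map_smul]
  module

theorem norm_shiftedEvolution_sub_le (hH : IsSelfAdjoint H) {x y : E}
    (hxy : (x, y) ∈ (shift H c).graph) (t : ℝ) :
    ‖shiftedEvolution H c t x - x‖ ≤ ‖y‖ * |t| := by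
  have := norm_le_of_hasDerivAt_bound (f := fun s => shiftedEvolution H c s x - x) (b := ‖y‖)
    (c := 0) (by simp [shiftedEvolution_zero hH])
    (fun s => (hasDerivAt_shiftedEvolution hH hxy s).sub_const x)
    (fun s => by simp [norm_smul, norm_shiftedEvolution_apply hH]) t
  simpa using this

/-- The derivative of the remainder has norm at most `‖z‖ * |s|`; integrating it produces the factor
one half of the final bound. -/
theorem norm_shiftedEvolution_sub_add_le (hH : IsSelfAdjoint H) {x y z : E}
    (hxy : (x, y) ∈ (shift H c).graph) (hyz : (y, z) ∈ (shift H c).graph) (t : ℝ) :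
    ‖shiftedEvolution H c t x - x + t • Complex.I • y‖ ≤ ‖z‖ / 2 * t ^ 2 := by
  have hd : ∀ s, HasDerivAt (fun s : ℝ => shiftedEvolution H c s x - x + s • Complex.I • y)
      (-(Complex.I • (shiftedEvolution H c s y - y))) s := by
    intro s
    have h := ((hasDerivAt_shiftedEvolution hH hxy s).sub_const x).add
      ((hasDerivAt_id s).smul_const (Complex.I • y))
    refine h.congr_deriv ?_
    rw [one_smul, smul_sub]; abel
  have := norm_le_of_hasDerivAt_bound (b := 0) (c := ‖z‖) (by simp [shiftedEvolution_zero hH]) hd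
    (fun s => by
      rw [norm_neg, norm_smul, Complex.norm_I, one_mul, zero_add]
      exact norm_shiftedEvolution_sub_le hH hyz s) t
  simpa using this

end ShiftedEvolution

/-! ### Products and powers of isometries. -/

section Products

theorem prod_map_smul {ι A : Type*} [Semiring A] [Algebra ℂ A] (c : ι → ℂ) (U : ι → A)
    (l : List ι) :
    (l.map fun k => c k • U k).prod = (l.map c).prod • (l.map U).prod := by
  induction l with
  | nil => simp
  | cons k l ih =>
    simp only [List.map_cons, List.prod_cons, ih]
    rw [smul_mul_smul_comm]

theorem prod_map_mul_prod_map_reverse {ι A : Type*} [Monoid A] {U V : ι → A}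
    (h : ∀ k, U k * V k = 1) (l : List ι) : (l.map U).prod * (l.reverse.map V).prod = 1 := by
  induction l with
  | nil => simp
  | cons k l ih =>
    rw [List.reverse_cons, List.map_append, List.prod_append, List.map_cons, List.prod_cons,
      mul_assoc, ← mul_assoc (l.map U).prod, ih]
    simp [h]

variable {E : Type*} [NormedAddCommGroup E] [NormedSpace ℂ E]

theorem norm_list_prod_apply {l : List (E →L[ℂ] E)} (h : ∀ U ∈ l, ∀ x, ‖U x‖ = ‖x‖) (x : E) :
    ‖l.prod x‖ = ‖x‖ := by
  induction l with
  | nil => simp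
  | cons U l ih =>
    rw [List.prod_cons, mul_apply_eq_comp, h U List.mem_cons_self]
    exact ih fun V hV => h V (List.mem_cons_of_mem U hV)

theorem norm_pow_apply_sub_le {V : E →L[ℂ] E} (hV : ∀ x, ‖V x‖ = ‖x‖) (x : E) (N : ℕ) :
    ‖(V ^ N) x - x‖ ≤ N * ‖V x - x‖ := by
  induction N with
  | zero => simp
  | succ N ih =>
    have h1 : (V ^ (N + 1)) x - x = V ((V ^ N) x - x) + (V x - x) := by
      rw [pow_succ', mul_apply_eq_comp, map_sub]; abel
    rw [h1]
    have h2 := norm_add_le (V ((V ^ N) x - x)) (V x - x)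
    rw [hV] at h2
    rw [Nat.cast_succ]
    linarith

/-- The first-order expansion of a product of isometries, each of which has a first-order
expansion `φ ↦ φ - i s y_k`. -/
theorem norm_prod_reverse_apply_sub_le {L : ℕ} {W : Fin L → E →L[ℂ] E} {φ : E} {y : Fin L → E}
    {s : ℝ} {a b : Fin L → ℝ} (hW : ∀ k x, ‖W k x‖ = ‖x‖)
    (ha : ∀ k, ‖W k φ - φ + s • Complex.I • y k‖ ≤ a k)
    (hb : ∀ k, |s| * ‖W k (∑ i ∈ Finset.Iio k, y i) - ∑ i ∈ Finset.Iio k, y i‖ ≤ b k) :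
    ‖(List.ofFn W).reverse.prod φ - φ + s • Complex.I • ∑ k, y k‖ ≤ ∑ k, (a k + b k) := by
  induction L with
  | zero => simp
  | succ L ih =>
    have hIio : ∀ k : Fin L, ∑ i ∈ Finset.Iio k.castSucc, y i =
        ∑ i ∈ Finset.Iio k, y i.castSucc := fun k => by
      rw [Fin.Iio_castSucc, Finset.sum_map]; rfl
    have hlast : ∑ i ∈ Finset.Iio (Fin.last L), y i = ∑ i : Fin L, y i.castSucc := by
      rw [Fin.Iio_last_eq_map, Finset.sum_map]; rfl
    have h1 := ih (W := fun k => W k.castSucc) (y := fun k => y k.castSucc)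
      (a := fun k => a k.castSucc) (b := fun k => b k.castSucc)
      (fun k => hW _) (fun k => ha _) (fun k => by rw [← hIio]; exact hb _)
    have h2 := ha (Fin.last L)
    have h3 := hb (Fin.last L)
    rw [hlast] at h3
    rw [List.ofFn_succ', List.concat_eq_append, List.reverse_append, List.prod_append,
      Fin.sum_univ_castSucc, Fin.sum_univ_castSucc (fun k => a k + b k)]
    set P := (List.ofFn fun k : Fin L => W k.castSucc).reverse.prod
    set Y := ∑ k : Fin L, y k.castSucc
    set T := W (Fin.last L) with hT
    -- The new remainder is the image under `T` of the old one, plus the Taylor remainder of `T` at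
    -- `φ`, minus the displacement of the accumulated linear term.
    have h4 : ([T].reverse.prod * P) φ - φ + s • Complex.I • (Y + y (Fin.last L)) =
        T (P φ - φ + s • Complex.I • Y) + (T φ - φ + s • Complex.I • y (Fin.last L)) -
          s • Complex.I • (T Y - Y) := by
      have h5 : T (s • Complex.I • Y) = s • Complex.I • T Y := by
        rw [← Complex.coe_smul, map_smul, map_smul, Complex.coe_smul]
      simp only [List.reverse_singleton, List.prod_singleton, mul_apply_eq_comp,
        map_add, map_sub, h5, smul_add, smul_sub]
      abel
    rw [h4]
    have h6 : ‖s • Complex.I • (T Y - Y)‖ = |s| * ‖T Y - Y‖ := by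
      rw [norm_smul, norm_smul, Complex.norm_I, one_mul, Real.norm_eq_abs]
    have h7 := norm_sub_le (T (P φ - φ + s • Complex.I • Y) +
      (T φ - φ + s • Complex.I • y (Fin.last L))) (s • Complex.I • (T Y - Y))
    have h8 := norm_add_le (T (P φ - φ + s • Complex.I • Y))
      (T φ - φ + s • Complex.I • y (Fin.last L))
    rw [hW] at h8
    linarith

end Products

/-- Passing from the one-step error of an isometry `e^{irs} T` to the `N`-step error of `T`. -/
theorem norm_pow_apply_sub_exp_smul_le {E : Type*} [NormedAddCommGroup E]
    [NormedSpace ℂ E] {T V : E →L[ℂ] E} {r t : ℝ} {N : ℕ} (hN : 0 < N)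
    (hV : ∀ x, ‖V x‖ = ‖x‖) (hTV : V = Complex.exp (Complex.I * r * (t / N : ℝ)) • T)
    {φ : E} {C : ℝ} (hC : ‖V φ - φ‖ ≤ (t / N) ^ 2 * C) :
    ‖(T ^ N) φ - Complex.exp (-(Complex.I * t * r)) • φ‖ ≤ t ^ 2 / N * C := by
  have hN' : (N : ℝ) ≠ 0 := by positivity
  have hN'' : (N : ℂ) ≠ 0 := by exact_mod_cast hN.ne'
  have h1 : V ^ N = Complex.exp (Complex.I * r * t) • T ^ N := by
    rw [hTV, smul_pow, ← Complex.exp_nat_mul]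
    congr 2
    push_cast
    field_simp
  have h2 : (V ^ N) φ - φ = Complex.exp (Complex.I * r * t) •
      ((T ^ N) φ - Complex.exp (-(Complex.I * t * r)) • φ) := by
    rw [h1, smul_sub, smul_smul, ← Complex.exp_add, smul_apply,
      show Complex.I * r * t + -(Complex.I * t * r) = 0 by ring, Complex.exp_zero, one_smul]
  have h3 := norm_pow_apply_sub_le hV φ N
  rw [h2, norm_smul, norm_exp_I_mul_mul, one_mul] at h3
  refine h3.trans ((mul_le_mul_of_nonneg_left hC (Nat.cast_nonneg N)).trans_eq ?_)
  field_simp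

/-! ### One Trotter step in either order. -/

section Trotter

variable {E : Type*} [NormedAddCommGroup E] [InnerProductSpace ℂ E] [CompleteSpace E] {L : ℕ}
  {H : Fin L → E →ₗ.[ℂ] E}

theorem prod_exp_eq {c : Fin L → ℝ} {r : ℝ} (hc : ∑ k, c k = r) (s : ℝ) :
    ∏ k, Complex.exp (Complex.I * c k * s) = Complex.exp (Complex.I * r * s) := by
  rw [← Complex.exp_sum, ← Finset.sum_mul, ← Finset.mul_sum, ← hc, Complex.ofReal_sum]

theorem trotterStep_eq {c : Fin L → ℝ} {r : ℝ} (hc : ∑ k, c k = r) (s : ℝ) :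
    (List.ofFn fun k => shiftedEvolution (H k) (c k) s).reverse.prod =
      Complex.exp (Complex.I * r * s) • trotterStep H s := by
  simp only [trotterStep, shiftedEvolution, List.ofFn_eq_map, ← List.map_reverse]
  rw [prod_map_smul, List.map_reverse, (List.reverse_perm _).prod_eq, ← List.ofFn_eq_map,
    List.prod_ofFn, prod_exp_eq hc]

theorem trotterStepRev_eq {c : Fin L → ℝ} {r : ℝ} (hc : ∑ k, c k = r) (s : ℝ) :
    (List.ofFn fun k => shiftedEvolution (H k) (c k) s).prod =
      Complex.exp (Complex.I * r * s) • trotterStepRev H s := by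
  simp only [trotterStepRev, shiftedEvolution, List.ofFn_eq_map]
  rw [prod_map_smul, ← List.ofFn_eq_map, List.prod_ofFn, prod_exp_eq hc]

theorem norm_shifted_trotterStep_sub_le (hH : ∀ k, IsSelfAdjoint (H k)) {c : Fin L → ℝ} {φ : E}
    {y q m : Fin L → E} (hy : ∀ k, (φ, y k) ∈ (shift (H k) (c k)).graph)
    (hq : ∀ k, (y k, q k) ∈ (shift (H k) (c k)).graph)
    (hm : ∀ k, (∑ i ∈ Finset.Iio k, y i, m k) ∈ (shift (H k) (c k)).graph)
    (hsum : ∑ k, y k = 0) (s : ℝ) :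
    ‖(List.ofFn fun k => shiftedEvolution (H k) (c k) s).reverse.prod φ - φ‖ ≤
      s ^ 2 * ∑ k, (1 / 2 * ‖q k‖ + ‖m k‖) := by
  have h := norm_prod_reverse_apply_sub_le (s := s) (φ := φ)
    (fun k x => norm_shiftedEvolution_apply (c := c k) (hH k) s x)
    (fun k => norm_shiftedEvolution_sub_add_le (hH k) (hy k) (hq k) s)
    (fun k => mul_le_mul_of_nonneg_left
      (norm_shiftedEvolution_sub_le (hH k) (hm k) s) (abs_nonneg s))
  rw [hsum, smul_zero, smul_zero, add_zero] at h
  refine h.trans_eq ?_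
  rw [Finset.mul_sum]
  refine Finset.sum_congr rfl fun k _ => ?_
  rw [← sq_abs s]
  ring

/-- The two products `V` and `W` satisfy `V W = 1`, so `V φ - φ = -V (W φ - φ)`, and `V` is
isometric. -/
theorem norm_shifted_trotterStepRev_sub_eq (hH : ∀ k, IsSelfAdjoint (H k)) (c : Fin L → ℝ)
    (φ : E) (s : ℝ) :
    ‖(List.ofFn fun k => shiftedEvolution (H k) (c k) s).prod φ - φ‖ =
      ‖(List.ofFn fun k => shiftedEvolution (H k) (c k) (-s)).reverse.prod φ - φ‖ := by
  set V := (List.ofFn fun k => shiftedEvolution (H k) (c k) s).prod with hV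
  set W := (List.ofFn fun k => shiftedEvolution (H k) (c k) (-s)).reverse.prod with hW
  have hVW : V * W = 1 := by
    rw [hV, hW, List.ofFn_eq_map, List.ofFn_eq_map, ← List.map_reverse]
    exact prod_map_mul_prod_map_reverse (fun k => shiftedEvolution_mul_neg (hH k) s) _
  have hiso : ∀ x, ‖V x‖ = ‖x‖ := norm_list_prod_apply fun U hU x => by
    obtain ⟨k, rfl⟩ := List.mem_ofFn.1 hU
    exact norm_shiftedEvolution_apply (hH k) s x
  have h1 : V φ - φ = -V (W φ - φ) := by
    rw [map_sub, ← mul_apply_eq_comp V W, hVW, neg_sub]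
    rfl
  rw [h1, norm_neg, hiso]

end Trotter

/-- A sum of symmetric operators is symmetric. Reality of `h` is what gives the phases modulus one.
-/
theorem im_eq_zero_of_eigenvector {E : Type*} [NormedAddCommGroup E] [InnerProductSpace ℂ E]
    [CompleteSpace E] {ι : Type*} {s : Finset ι} {H : ι → E →ₗ.[ℂ] E}
    (hH : ∀ k, IsSelfAdjoint (H k)) {φ : E} (hφ0 : φ ≠ 0) {y : ι → E}
    (hy : ∀ k, (φ, y k) ∈ (H k).graph) {h : ℂ} (hsum : ∑ k ∈ s, y k = h • φ) : h.im = 0 := by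
  have h1 : inner ℂ (h • φ) φ = inner ℂ φ (h • φ) := by
    rw [← hsum, sum_inner, inner_sum]
    exact Finset.sum_congr rfl fun k _ => inner_graph_comm (hH k) (hy k) (hy k)
  rw [inner_smul_left, inner_smul_right] at h1
  exact Complex.conj_eq_iff_im.1 (mul_right_cancel₀ (inner_self_ne_zero.2 hφ0) h1)

end StateTrotter

/-! ### Domain conditions and the final bound. -/

theorem mainTheorem2 {E : Type*} [NormedAddCommGroup E] [InnerProductSpace ℂ E] [CompleteSpace E]
    {L : ℕ} (H : Fin L → E →ₗ.[ℂ] E) (hH : ∀ j, IsSelfAdjoint (H j))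
    (h : ℂ) (φ : E) (hφ0 : φ ≠ 0) (hφ : φ ∈ (∑ j, H j).domain)
    (heig : (∑ j, H j) ⟨φ, hφ⟩ = h • φ)
    (hφsq : ∀ j, φ ∈ (StateTrotter.mulOp (H j) (H j)).domain)
    (hφmix : ∀ k : Fin L, 0 < (k : ℕ) → (k : ℕ) + 1 < L →
      φ ∈ (StateTrotter.mulOp (H k) (∑ i ∈ Finset.Iio k, H i)).domain)
    (g : Fin L → ℝ) (hg : ∑ k, g k = 1) (t : ℝ) (N : ℕ) (hN : 0 < N) :
    ∃ (hsq : ∀ k, φ ∈ (StateTrotter.mulOp (StateTrotter.shift (H k) (h * g k))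
          (StateTrotter.shift (H k) (h * g k))).domain)
      (hmix : ∀ k, φ ∈ (StateTrotter.mulOp (StateTrotter.shift (H k) (h * g k))
          (∑ i ∈ Finset.Iio k, StateTrotter.shift (H i) (h * g i))).domain),
      ‖(StateTrotter.trotterStep H (t / N) ^ N) φ - Complex.exp (-(Complex.I * t * h)) • φ‖
          ≤ t ^ 2 / N * ∑ k,
            (1 / 2 * ‖StateTrotter.mulOp (StateTrotter.shift (H k) (h * g k))
                (StateTrotter.shift (H k) (h * g k)) ⟨φ, hsq k⟩‖
              + ‖StateTrotter.mulOp (StateTrotter.shift (H k) (h * g k))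
                (∑ i ∈ Finset.Iio k, StateTrotter.shift (H i) (h * g i)) ⟨φ, hmix k⟩‖) ∧
      ‖(StateTrotter.trotterStepRev H (t / N) ^ N) φ - Complex.exp (-(Complex.I * t * h)) • φ‖
          ≤ t ^ 2 / N * ∑ k,
            (1 / 2 * ‖StateTrotter.mulOp (StateTrotter.shift (H k) (h * g k))
                (StateTrotter.shift (H k) (h * g k)) ⟨φ, hsq k⟩‖
              + ‖StateTrotter.mulOp (StateTrotter.shift (H k) (h * g k))
                (∑ i ∈ Finset.Iio k, StateTrotter.shift (H i) (h * g i)) ⟨φ, hmix k⟩‖) := by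
  let y : Fin L → E := fun k => H k ⟨φ, StateTrotter.mem_domain_of_mem_domain_sum hφ k
    (Finset.mem_univ k)⟩
  have hy : ∀ k, (φ, y k) ∈ (H k).graph := fun k =>
    LinearPMap.mem_graph (H k) ⟨φ, _⟩
  have hysum : ∑ k, y k = h • φ := by
    rw [← heig]
    exact (StateTrotter.eq_of_mem_graph hφ (StateTrotter.mem_graph_sum fun k _ => hy k)).symm
  obtain ⟨r, rfl⟩ : ∃ r : ℝ, (r : ℂ) = h :=
    ⟨h.re, Complex.ext rfl (StateTrotter.im_eq_zero_of_eigenvector hH hφ0 hy hysum).symm⟩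
  obtain ⟨c, hcdef⟩ : ∃ c : Fin L → ℝ, ∀ k, c k = r * g k := ⟨_, fun _ => rfl⟩
  have hcast : ∀ k, (r : ℂ) * g k = (c k : ℂ) := fun k => by rw [hcdef, Complex.ofReal_mul]
  have hc : ∑ k, c k = r := by simp only [hcdef, ← Finset.mul_sum, hg, mul_one]
  let w : Fin L → E := fun k => y k - (c k : ℂ) • φ
  have hw : ∀ k, (φ, w k) ∈ (StateTrotter.shift (H k) (c k)).graph := fun k => by
    rw [StateTrotter.mem_graph_shift, sub_add_cancel]
    exact hy k
  have hwsum : ∑ k, w k = 0 := by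
    rw [Finset.sum_sub_distrib, ← Finset.sum_smul, ← Complex.ofReal_sum, hc, hysum, sub_self]
  have hφdom : ∀ k, φ ∈ (H k).domain := fun k => LinearPMap.mem_domain_of_mem_graph (hy k)
  have hwdom : ∀ k, w k ∈ (StateTrotter.shift (H k) (c k)).domain := fun k =>
    Submodule.sub_mem _ (StateTrotter.mem_domain_of_mem_domain_mulOp (hφsq k) (hy k))
      (Submodule.smul_mem _ _ (hφdom k))
  have hpdom : ∀ k, ∑ i ∈ Finset.Iio k, w i ∈ (StateTrotter.shift (H k) (c k)).domain := by
    intro k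
    rcases Nat.eq_zero_or_pos (k : ℕ) with hk | hk
    · have : Finset.Iio k = ∅ := Finset.eq_empty_of_forall_notMem fun i hi => by
        have := Fin.lt_def.1 (Finset.mem_Iio.1 hi)
        omega
      rw [this, Finset.sum_empty]
      exact Submodule.zero_mem _
    rcases Nat.lt_or_ge (k + 1 : ℕ) L with hkL | hkL
    · rw [Finset.sum_sub_distrib, ← Finset.sum_smul]
      exact Submodule.sub_mem _ (StateTrotter.mem_domain_of_mem_domain_mulOp (hφmix k hk hkL)
        (StateTrotter.mem_graph_sum fun i _ => hy i)) (Submodule.smul_mem _ _ (hφdom k))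
    -- At the last index the partial sum is `-w k`, because all the `w i` sum to zero; its domain
    -- condition thus follows from the one on squares.
    · have h1 : insert k (Finset.Iio k) = Finset.univ := Finset.eq_univ_of_forall fun i => by
        have := i.2
        rw [Finset.mem_insert, Finset.mem_Iio, Fin.lt_def, Fin.ext_iff]
        omega
      have h2 := Finset.sum_insert (f := w) (Finset.notMem_Iio_self (b := k))
      rw [h1, hwsum] at h2
      rw [eq_neg_of_add_eq_zero_right h2.symm]
      exact Submodule.neg_mem _ (hwdom k)
  choose q hq using fun k => LinearPMap.mem_domain_iff.1 (hwdom k)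
  choose m hm using fun k => LinearPMap.mem_domain_iff.1 (hpdom k)
  have hsq : ∀ k, (φ, q k) ∈ (StateTrotter.mulOp (StateTrotter.shift (H k) (r * g k))
      (StateTrotter.shift (H k) (r * g k))).graph := fun k => by
    rw [hcast]
    exact StateTrotter.mem_graph_mulOp (hw k) (hq k)
  have hmix : ∀ k, (φ, m k) ∈ (StateTrotter.mulOp (StateTrotter.shift (H k) (r * g k))
      (∑ i ∈ Finset.Iio k, StateTrotter.shift (H i) (r * g i))).graph := fun k => by
    simp only [hcast]
    exact StateTrotter.mem_graph_mulOp (StateTrotter.mem_graph_sum fun i _ => hw i) (hm k)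
  have hsq' := fun k => LinearPMap.mem_domain_of_mem_graph (hsq k)
  have hmix' := fun k => LinearPMap.mem_domain_of_mem_graph (hmix k)
  refine ⟨hsq', hmix', ?_⟩
  simp only [fun k => StateTrotter.eq_of_mem_graph (hsq' k) (hsq k),
    fun k => StateTrotter.eq_of_mem_graph (hmix' k) (hmix k)]
  have hiso : ∀ U ∈ List.ofFn fun k => StateTrotter.shiftedEvolution (H k) (c k) (t / N),
      ∀ x, ‖U x‖ = ‖x‖ := fun U hU x => by
    obtain ⟨k, rfl⟩ := List.mem_ofFn.1 hU
    exact StateTrotter.norm_shiftedEvolution_apply (hH k) _ x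
  constructor
  · refine StateTrotter.norm_pow_apply_sub_exp_smul_le hN
      (StateTrotter.norm_list_prod_apply fun U hU => hiso U (List.mem_reverse.1 hU))
      (StateTrotter.trotterStep_eq hc (t / N)) ?_
    exact StateTrotter.norm_shifted_trotterStep_sub_le hH hw hq hm hwsum (t / N)
  · refine StateTrotter.norm_pow_apply_sub_exp_smul_le hN (StateTrotter.norm_list_prod_apply hiso)
      (StateTrotter.trotterStepRev_eq hc (t / N)) ?_
    -- The one-step bound is even in time, so the sign change is harmless.
    rw [StateTrotter.norm_shifted_trotterStepRev_sub_eq hH, ← neg_sq (t / N : ℝ)]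
    exact StateTrotter.norm_shifted_trotterStep_sub_le hH hw hq hm hwsum (-(t / N))
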